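/- Let $\omega\in\mathbb C$, let $J$ be the bounded operator on $\ell^2(\mathbb Z_+)$, $\mathbb Z_+=\{0,1,2,\dots\}$, with tridiagonal matrix $J_{0,0}=\omega$, $J_{n,n}=0$ for $n\ge1$, $J_{n,n+1}=J_{n+1,n}=1$ for $n\ge0$, and all other entries zero. Let $\mathcal C$ be entrywise complex conjugation, let $B=J\mathcal C$ (a bounded anti-linear operator with $\langle Bx,y\rangle=\langle By,x\rangle$ for all $x,y$, the inner product being linear in the first argument), let $|B|=\sqrt{B^2}$, and let $\delta=e_0=(1,0,0,\dots)$, which is cyclic for $B$. The spectral data of $B$ is the pair $(\nu,\psi)$, where $\nu$ is a probability measure on $[0,\infty)$ and $\psi\in L^\infty(s\,\mathrm d\nu(s))$ is complex-valued, such that for all continuous $f:\mathbb R\to\mathbb C$ $$\langle f(|B|)\delta,\delta\rangle=\int_0^\infty f(s)\,\mathrm d\nu(s),\qquad \langle f(|B|)B\delta,\delta\rangle=\int_0^\infty s f(s)\psi(s)\,\mathrm d\nu(s).$$ **Proposition.** Such a pair exists, and every such pair $(\nu,\psi)$ is given as follows. The measure is $\nu=\nu_{\mathrm{ac}}+\nu_{\mathrm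 s}$, where $\nu_{\mathrm{ac}}$ is absolutely continuous with respect to Lebesgue measure, supported on $[0,2]$, with density $$\frac{\mathrm d\nu_{\mathrm{ac}}}{\mathrm ds}(s)=\frac{|\omega|^2+1}{\pi}\,\frac{\sqrt{4-s^2}}{(1+|\omega|^2)^2-|\omega|^2s^2},\qquad \text{for a.e. } s\in[0,2].$$ The singular part $\nu_{\mathrm s}$ is non-zero if and only if $|\omega|>1$, in which case $$\nu_{\mathrm s}=\frac{|\omega|^2-1}{|\omega|^2}\,\delta_{|\omega|+|\omega|^{-1}},$$ the point mass at $|\omega|+|\omega|^{-1}$ with weight $\frac{|\omega|^2-1}{|\omega|^2}$. The function $\psi$ satisfies $$\psi(s)=\frac{\omega s}{1+|\omega|^2}\qquad\text{for } \nu\text{-a.e. } s\in[0,2],$$ and, if $|\omega|>1$, also $\psi(|\omega|+|\omega|^{-1})=\dfrac{\omega}{|\omega|}$. -/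

import Mathlib

open MeasureTheory Set
open scoped ENNReal InnerProductSpace

namespace AntiLinear

noncomputable section

section Definitions

variable {H : Type*} [NormedAddCommGroup H] [InnerProductSpace ℂ H]

/-- Symmetry of a bounded anti-linear operator `B`: `⟨Bx, y⟩ = ⟨By, x⟩`, where `⟨·, ·⟩` is linear
in the first and anti-linear in the second argument (so `⟨u, v⟩` is Mathlib's `inner ℂ v u`). -/
def IsSymm (B : H →L⋆[ℂ] H) : Prop :=
  ∀ x y : H, ⟪y, B x⟫_ℂ = ⟪x, B y⟫_ℂ

/-- The square `B²` of an anti-linear operator, a linear operator. -/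
def sq (B : H →L⋆[ℂ] H) : H →L[ℂ] H := B.comp B

/-- For symmetric `B`, the square `B²` is positive semi-definite. -/
theorem IsSymm.isPositive_sq [CompleteSpace H] {B : H →L⋆[ℂ] H} (hB : IsSymm B) :
    (sq B).IsPositive := by
  rw [ContinuousLinearMap.isPositive_iff_complex]
  intro x
  have h : ⟪sq B x, x⟫_ℂ = ⟪B x, B x⟫_ℂ := by
    rw [← inner_conj_symm (sq B x) x, ← inner_conj_symm (B x) (B x)]
    exact congrArg _ (hB (B x) x)
  rw [h]
  exact ⟨by simpa using (inner_self_ofReal_re (𝕜 := ℂ) (B x)), inner_self_nonneg⟩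

/-- The vector `δ` is cyclic for `B`: the vectors `f(B) δ`, with `f` a complex polynomial, i.e. the
linear combinations of `δ, Bδ, B²δ, …`, are dense. -/
def IsCyclic (B : H →L⋆[ℂ] H) (δ : H) : Prop :=
  Dense (Submodule.span ℂ (range fun n : ℕ => B^[n] δ) : Set H)

variable [CompleteSpace H]

/-- The modulus `|B| = √(B²)`, the positive square root of the positive operator `B²`. -/
def modulus (B : H →L⋆[ℂ] H) : H →L[ℂ] H := CFC.sqrt (sq B)

/-- The operator `f(|B|)` for a complex-valued function `f` of a real variable
(continuous functional calculus of the self-adjoint operator `|B|`). -/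
def funModulus (B : H →L⋆[ℂ] H) (f : ℝ → ℂ) : H →L[ℂ] H :=
  cfc (fun z : ℂ => f z.re) (modulus B)

/-- `(ν, ψ)` is the spectral data of the bounded symmetric anti-linear operator `B` with respect
to the vector `δ`: `ν` is a probability measure on `[0, ∞)`, `ψ ∈ L^∞(s dν(s))`, and for all
continuous `f : ℝ → ℂ`
`⟨f(|B|) δ, δ⟩ = ∫ f(s) dν(s)` and `⟨f(|B|) B δ, δ⟩ = ∫ s f(s) ψ(s) dν(s)`
(inner products linear in the first argument; the integrals converge absolutely). -/
structure IsSpectralData (B : H →L⋆[ℂ] H) (δ : H) (ν : Measure ℝ) (ψ : ℝ → ℂ) : Prop where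
  isProbabilityMeasure : IsProbabilityMeasure ν
  measure_Iio : ν (Iio 0) = 0
  memLp_phase : MemLp ψ ∞ (ν.withDensity fun s => ENNReal.ofReal s)
  integrable_measure : ∀ f : ℝ → ℂ, Continuous f → Integrable f ν
  inner_measure : ∀ f : ℝ → ℂ, Continuous f → ⟪δ, funModulus B f δ⟫_ℂ = ∫ s, f s ∂ν
  integrable_phase : ∀ f : ℝ → ℂ, Continuous f → Integrable (fun s : ℝ => (s : ℂ) * f s * ψ s) ν
  inner_phase : ∀ f : ℝ → ℂ, Continuous f →
    ⟪δ, funModulus B f (B δ)⟫_ℂ = ∫ s : ℝ, (s : ℂ) * f s * ψ s ∂ν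

end Definitions

/-- The Hilbert space `ℓ²(ℤ₊)`, `ℤ₊ = {0, 1, 2, …}`. -/
abbrev L2N : Type := lp (fun _ : ℕ => ℂ) 2

/-- The standard basis vector `eₙ` of `ℓ²(ℤ₊)`. -/
def e (n : ℕ) : L2N := lp.single 2 n 1

/-- Complex conjugation `x ↦ x̄` (entrywise) on `ℓ²(ℤ₊)`. -/
def conjL2 : L2N →L⋆[ℂ] L2N :=
  ((starₗᵢ ℂ : L2N ≃ₗᵢ⋆[ℂ] L2N).toContinuousLinearEquiv : L2N →L⋆[ℂ] L2N)

theorem conjL2_apply (x : L2N) (n : ℕ) : conjL2 x n = starRingEnd ℂ (x n) := rfl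

/-- The sequence `(0, x₀, x₁, …)`. -/
def shiftFun (x : ℕ → ℂ) : ℕ → ℂ
  | 0 => 0
  | n + 1 => x n

theorem hasSum_shiftFun (x : L2N) :
    HasSum (fun n => ‖shiftFun x n‖ ^ (2 : ℝ≥0∞).toReal) (‖x‖ ^ (2 : ℝ≥0∞).toReal) := by
  rw [← hasSum_nat_add_iff' 1]
  simpa [shiftFun] using lp.hasSum_norm (p := 2) (by simp) x

/-- The right shift `(x₀, x₁, …) ↦ (0, x₀, x₁, …)` on `ℓ²(ℤ₊)`. -/
def rightShift : L2N →L[ℂ] L2N :=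
  LinearMap.mkContinuous
    { toFun := fun x => ⟨shiftFun x, memℓp_gen (hasSum_shiftFun x).summable⟩
      map_add' := fun x y => by
        ext n
        cases n with
        | zero => exact (add_zero (0 : ℂ)).symm
        | succ n => rfl
      map_smul' := fun c x => by
        ext n
        cases n <;> simp [shiftFun] }
    1
    (fun x => by
      have h1 := (hasSum_shiftFun x).unique
        (lp.hasSum_norm (p := 2) (by simp)
          (⟨shiftFun x, memℓp_gen (hasSum_shiftFun x).summable⟩ : L2N))
      rw [one_mul]
      exact le_of_eq
        ((Real.rpow_left_inj (norm_nonneg _) (norm_nonneg _) (by simp)).1 h1.symm))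

theorem rightShift_zero (x : L2N) : rightShift x 0 = 0 := rfl

theorem rightShift_succ (x : L2N) (n : ℕ) : rightShift x (n + 1) = x n := rfl

theorem rightShift_e (n : ℕ) : rightShift (e n) = e (n + 1) := by
  ext k
  cases k with
  | zero => simp [rightShift_zero, e]
  | succ k => simp [rightShift_succ, e, Pi.single_apply]

theorem adjoint_rightShift_apply (x : L2N) (n : ℕ) :
    ContinuousLinearMap.adjoint rightShift x n = x (n + 1) := by
  have h := ContinuousLinearMap.adjoint_inner_right rightShift (e n) x
  rw [rightShift_e] at h
  simpa [e, lp.inner_single_left] using h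

/-- The Jacobi matrix with `ω` at the entry `(0, 0)`, zeros elsewhere on the diagonal, and ones
next to the diagonal. -/
def jacobiMatrix (ω : ℂ) : Matrix ℕ ℕ ℂ := fun m n =>
  if m = 0 ∧ n = 0 then ω else if m = n + 1 ∨ n = m + 1 then 1 else 0

/-- The bounded operator `J` on `ℓ²(ℤ₊)` given by the matrix `jacobiMatrix ω`: the sum of the
right shift, the left shift (its adjoint) and `x ↦ ω x₀ e₀`. The two facts below show that this is
the operator of that matrix. -/
def jacobi (ω : ℂ) : L2N →L[ℂ] L2N :=
  rightShift + ContinuousLinearMap.adjoint rightShift +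
    ω • (innerSL ℂ (e 0)).smulRight (e 0)

theorem jacobi_apply (ω : ℂ) (x : L2N) :
    jacobi ω x 0 = ω * x 0 + x 1 ∧ ∀ n, jacobi ω x (n + 1) = x n + x (n + 2) := by
  have h : ∀ n, jacobi ω x n = rightShift x n + ContinuousLinearMap.adjoint rightShift x n +
      ω * (⟪e 0, x⟫_ℂ * e 0 n) := fun n => rfl
  constructor
  · rw [h, rightShift_zero, adjoint_rightShift_apply]
    simp [e, lp.inner_single_left]
    ring
  · intro n
    rw [h, rightShift_succ, adjoint_rightShift_apply]
    simp [e]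

theorem inner_jacobi (ω : ℂ) (m n : ℕ) : ⟪e m, jacobi ω (e n)⟫_ℂ = jacobiMatrix ω m n := by
  have h : ⟪e m, jacobi ω (e n)⟫_ℂ = jacobi ω (e n) m := by simp [e, lp.inner_single_left]
  rw [h]
  cases m with
  | zero =>
    rw [(jacobi_apply ω _).1]
    rcases n with _ | _ | n <;> simp [e, jacobiMatrix]
  | succ m =>
    rw [(jacobi_apply ω _).2]
    simp only [e, jacobiMatrix, lp.coeFn_single, Pi.single_apply]
    split_ifs <;> first | omega | simp_all

/-- The anti-linear operator `J 𝒞`, with `𝒞` the complex conjugation. -/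
def antiJacobi (ω : ℂ) : L2N →L⋆[ℂ] L2N := (jacobi ω).comp conjL2

theorem antiJacobi_isSymm (ω : ℂ) : IsSymm (antiJacobi ω) := by
  have hsum : ∀ u v : L2N, ⟪v, conjL2 u⟫_ℂ = ⟪u, conjL2 v⟫_ℂ := by
    intro u v
    rw [lp.inner_eq_tsum, lp.inner_eq_tsum]
    refine tsum_congr fun n => ?_
    simp [conjL2_apply, mul_comm]
  have hcomm : ∀ v : L2N, conjL2 (rightShift v) = rightShift (conjL2 v) := by
    intro v
    ext n
    cases n <;> simp [conjL2_apply, rightShift_zero, rightShift_succ]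
  have hcomm' : ∀ v : L2N, conjL2 (ContinuousLinearMap.adjoint rightShift v) =
      ContinuousLinearMap.adjoint rightShift (conjL2 v) := by
    intro v
    ext n
    simp [conjL2_apply, adjoint_rightShift_apply]
  intro x y
  have h1 : ⟪y, rightShift (conjL2 x)⟫_ℂ =
      ⟪x, ContinuousLinearMap.adjoint rightShift (conjL2 y)⟫_ℂ := by
    rw [← hcomm, hsum, ContinuousLinearMap.adjoint_inner_right]
  have h2 : ⟪y, ContinuousLinearMap.adjoint rightShift (conjL2 x)⟫_ℂ =
      ⟪x, rightShift (conjL2 y)⟫_ℂ := by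
    rw [← hcomm', hsum, ContinuousLinearMap.adjoint_inner_left]
  have h : ∀ v : L2N, antiJacobi ω v = rightShift (conjL2 v) +
      ContinuousLinearMap.adjoint rightShift (conjL2 v) + ω • ⟪e 0, conjL2 v⟫_ℂ • e 0 :=
    fun v => rfl
  rw [h, h]
  simp only [inner_add_right, inner_smul_right, h1, h2]
  simp [e, lp.inner_single_left, lp.inner_single_right, conjL2_apply]
  ring

theorem antiJacobi_isCyclic (ω : ℂ) : IsCyclic (antiJacobi ω) (e 0) := by
  have hmap : ∀ v ∈ Submodule.span ℂ (range fun n : ℕ => (antiJacobi ω)^[n] (e 0)),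
      antiJacobi ω v ∈ Submodule.span ℂ (range fun n : ℕ => (antiJacobi ω)^[n] (e 0)) := by
    intro v hv
    induction hv using Submodule.span_induction with
    | mem x hx =>
      obtain ⟨n, rfl⟩ := hx
      refine Submodule.subset_span ⟨n + 1, ?_⟩
      simp only [Function.iterate_succ_apply']
    | zero => simp
    | add x y _ _ hx hy => rw [map_add]; exact add_mem hx hy
    | smul c x _ hx => rw [map_smulₛₗ]; exact Submodule.smul_mem _ _ hx
  have hconj : ∀ n, conjL2 (e n) = e n := by
    intro n
    ext k
    rw [conjL2_apply]
    by_cases h : k = n <;> simp [e, h]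
  have hcoord : ∀ n k, antiJacobi ω (e n) k = jacobi ω (e n) k := by
    intro n k
    simp only [antiJacobi, ContinuousLinearMap.comp_apply, hconj]
  have hB0 : e 1 = antiJacobi ω (e 0) - ω • e 0 := by
    ext k
    simp only [lp.coeFn_sub, lp.coeFn_smul, Pi.sub_apply, Pi.smul_apply, hcoord]
    rcases k with _ | k
    · rw [(jacobi_apply ω _).1]; simp [e]
    · rw [(jacobi_apply ω _).2]; simp [e, Pi.single_apply]
  have hB : ∀ n, e (n + 2) = antiJacobi ω (e (n + 1)) - e n := by
    intro n
    ext k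
    simp only [lp.coeFn_sub, Pi.sub_apply, hcoord]
    rcases k with _ | k
    · rw [(jacobi_apply ω _).1]; simp [e, Pi.single_apply, eq_comm]
    · rw [(jacobi_apply ω _).2]
      simp only [e, lp.coeFn_single, Pi.single_apply]
      split_ifs <;> first | omega | simp
  have he : ∀ n, e n ∈ Submodule.span ℂ (range fun n : ℕ => (antiJacobi ω)^[n] (e 0)) ∧
      e (n + 1) ∈ Submodule.span ℂ (range fun n : ℕ => (antiJacobi ω)^[n] (e 0)) := by
    intro n
    induction n with
    | zero =>
      have h0 : e 0 ∈ Submodule.span ℂ (range fun n : ℕ => (antiJacobi ω)^[n] (e 0)) :=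
        Submodule.subset_span ⟨0, rfl⟩
      refine ⟨h0, ?_⟩
      rw [zero_add, hB0]
      exact sub_mem (hmap _ h0) (Submodule.smul_mem _ _ h0)
    | succ n ih =>
      refine ⟨ih.2, ?_⟩
      rw [hB]
      exact sub_mem (hmap _ ih.2) ih.1
  intro x
  refine mem_closure_of_tendsto (lp.hasSum_single (p := 2) (by simp) x)
    (Filter.Eventually.of_forall fun t => ?_)
  refine sum_mem fun n _ => ?_
  have h : lp.single 2 n (x n) = x n • e n := by
    rw [e, ← lp.single_smul, smul_eq_mul, mul_one]
  rw [h]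
  exact Submodule.smul_mem _ _ (he n).1

/-- The density of the absolutely continuous part: on `[0, 2]` it is
`(|ω|² + 1)/π · √(4 - s²) / ((1 + |ω|²)² - |ω|² s²)`, and it is zero elsewhere. -/
def acDensity (ω : ℂ) : ℝ → ℝ≥0∞ :=
  (Icc (0 : ℝ) 2).indicator fun s => ENNReal.ofReal
    ((‖ω‖ ^ 2 + 1) / Real.pi * (Real.sqrt (4 - s ^ 2) / ((1 + ‖ω‖ ^ 2) ^ 2 - ‖ω‖ ^ 2 * s ^ 2)))

end

end AntiLinear

namespace AntiLinear

/-! The candidate measure is checked through its moments, and uniqueness transfers the result to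
every pair. Put r = |ω|, q = r². Three facts carry the proof.

Moments of the measure. Its density is a constant times √(4 - s²)/D with D = (1+q)² - q s², and D
vanishes at the atom r + 1/r. Multiplying by D therefore leaves a semicircle law, to which the even
Chebyshev polynomials S_{2k}, k ≥ 1, are orthogonal. This is a three-term recurrence for ∫ S_{2k}
dν, solved by q^k (`integral_chebyshevS`). Its initial value is the total mass, found from an
explicit antiderivative (`integral_baseDensity`); the mass missing on [0, 2] when r > 1 is the atom.

Moments of the operator. Spreading ν over ±s with weights (1 ± rs/(1+q))/2 gives a functional L with
L(S_n) = r^n, so L kills S_n - r S_{n-1} for n ≥ 1. These polynomials obey the recurrence of the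
Jacobi matrix with corner entry r. Antilinearity only adds a factor ω/|ω| in odd degree
(`inner_iterate_antiJacobi`). Even powers of B then give the moments of ν, odd powers those of sψ
dν.

Density. Polynomials in s² are uniformly dense in the continuous functions on [0, R], so these
moments determine the functional calculus of |B| (`inner_funModulus_eq_integral`). -/

/-! ### Chebyshev polynomials and the semicircle law -/

open Polynomial Filter Topology in
/-- The Chebyshev polynomials of even degree integrate against the semicircle density on `[0, 2]`
to zero, except for the constant one. -/
theorem integral_chebyshevS_mul_sqrt (k : ℕ) :
    ∫ s in (0 : ℝ)..2, (Chebyshev.S ℝ (2 * k)).eval s * √(4 - s ^ 2) =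
      if k = 0 then Real.pi else 0 := by
  have hS : ∀ θ : ℝ, (Chebyshev.S ℝ (2 * k)).eval (2 * Real.cos θ) * Real.sin θ =
      Real.sin ((2 * k + 1) * θ) := by
    intro θ
    have h := Chebyshev.U_real_cos θ (2 * k : ℤ)
    rw [← Chebyshev.S_comp_two_mul_X] at h
    simpa only [eval_comp, eval_mul, eval_ofNat, eval_X, Int.cast_mul, Int.cast_ofNat,
      Int.cast_natCast] using h
  -- Substitute s = 2 cos θ: S_{2k}(s) sin θ becomes sin((2k+1)θ), and the remaining product of
  -- sines is a difference of cosines of even frequency.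
  have hsub := intervalIntegral.integral_comp_mul_deriv (a := Real.pi / 2) (b := 0)
    (f := fun θ => 2 * Real.cos θ) (f' := fun θ => -(2 * Real.sin θ))
    (g := fun s => (Chebyshev.S ℝ (2 * k)).eval s * √(4 - s ^ 2))
    (fun θ _ => by simpa only [mul_neg] using (Real.hasDerivAt_cos θ).const_mul 2)
    (by fun_prop) (by fun_prop)
  simp only [Real.cos_pi_div_two, mul_zero, Real.cos_zero, mul_one] at hsub
  rw [← hsub, intervalIntegral.integral_symm]
  have hcongr : ∫ θ in (0 : ℝ)..(Real.pi / 2),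
      ((fun s => (Chebyshev.S ℝ (2 * k)).eval s * √(4 - s ^ 2)) ∘ fun θ => 2 * Real.cos θ) θ *
        -(2 * Real.sin θ) =
      ∫ θ in (0 : ℝ)..(Real.pi / 2),
        2 * (Real.cos ((2 * k + 2 : ℝ) * θ) - Real.cos ((2 * k : ℝ) * θ)) := by
    refine intervalIntegral.integral_congr fun θ hθ => ?_
    rw [uIcc_of_le (by positivity)] at hθ
    have hsin : 0 ≤ Real.sin θ :=
      Real.sin_nonneg_of_nonneg_of_le_pi hθ.1 (by linarith [hθ.2, Real.pi_pos])
    have hsqrt : √(4 - (2 * Real.cos θ) ^ 2) = 2 * Real.sin θ := by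
      rw [show 4 - (2 * Real.cos θ) ^ 2 = (2 * Real.sin θ) ^ 2 by
        nlinarith [Real.sin_sq_add_cos_sq θ]]
      exact Real.sqrt_sq (by positivity)
    simp only [Function.comp, hsqrt]
    have h1 : Real.cos ((2 * k + 2) * θ) = Real.cos ((2 * k + 1) * θ + θ) := by ring_nf
    have h2 : Real.cos (2 * k * θ) = Real.cos ((2 * k + 1) * θ - θ) := by ring_nf
    rw [h1, h2, Real.cos_add, Real.cos_sub, ← hS]
    ring
  rw [hcongr, intervalIntegral.integral_const_mul, intervalIntegral.integral_sub
    (by apply Continuous.intervalIntegrable; fun_prop)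
    (by apply Continuous.intervalIntegrable; fun_prop)]
  have hcos : ∀ m : ℕ, m ≠ 0 → ∫ θ in (0 : ℝ)..(Real.pi / 2), Real.cos ((2 * m : ℝ) * θ) = 0 := by
    intro m hm
    have hm' : (2 * m : ℝ) ≠ 0 := by positivity
    rw [intervalIntegral.integral_comp_mul_left (f := Real.cos) hm', integral_cos]
    rw [show (2 * m : ℝ) * (Real.pi / 2) = m * Real.pi by ring, Real.sin_nat_mul_pi]
    simp
  have h2 := hcos (k + 1) (by omega)
  rw [show ((2 * (k + 1 : ℕ) : ℝ)) = 2 * k + 2 by push_cast; ring] at h2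
  rw [h2]
  split_ifs with hk
  · subst hk
    simp
    ring
  · rw [hcos k hk]
    simp

/-! ### The absolutely continuous density and its mass -/

/-- `(1 - q)² ≥ 0`, in the form needed to compare the two sides of the density. -/
theorem mul_four_sub_sq_le (q s : ℝ) : q * (4 - s ^ 2) ≤ (1 + q) ^ 2 - q * s ^ 2 := by
  nlinarith [sq_nonneg (1 - q)]

theorem denominator_pos {q s : ℝ} (hq : 0 ≤ q) (hs : s ^ 2 < 4) :
    0 < (1 + q) ^ 2 - q * s ^ 2 := by
  rcases hq.eq_or_lt with rfl | hq
  · norm_num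
  · exact (mul_pos hq (by linarith)).trans_le (mul_four_sub_sq_le q s)

theorem sq_lt_four_of_mem_Ioo {s : ℝ} (hs : s ∈ Ioo (0 : ℝ) 2) : s ^ 2 < 4 := by
  nlinarith [hs.1, hs.2]

theorem sq_le_four_of_mem_Icc {s : ℝ} (hs : s ∈ Icc (0 : ℝ) 2) : s ^ 2 ≤ 4 := by
  nlinarith [hs.1, hs.2]

theorem hasDerivAt_arcsin_half {s : ℝ} (hs : s ∈ Ioo (0 : ℝ) 2) :
    HasDerivAt (fun x : ℝ => Real.arcsin (x / 2)) (√(4 - s ^ 2))⁻¹ s := by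
  have h := (Real.hasDerivAt_arcsin (x := s / 2) (by linarith [hs.1]) (by linarith [hs.2])).comp s
    ((hasDerivAt_id s).div_const 2)
  refine h.congr_deriv ?_
  have h4 : √(4 - s ^ 2) = 2 * √(1 - (s / 2) ^ 2) := by
    rw [show 4 - s ^ 2 = 2 ^ 2 * (1 - (s / 2) ^ 2) by ring, Real.sqrt_mul (by norm_num),
      Real.sqrt_sq (by norm_num)]
  rw [h4]
  field_simp

theorem intervalIntegrable_inv_sqrt :
    IntervalIntegrable (fun s : ℝ => (√(4 - s ^ 2))⁻¹) volume 0 2 := by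
  rw [intervalIntegrable_iff_integrableOn_Ioc_of_le (by norm_num)]
  exact intervalIntegral.integrableOn_deriv_of_nonneg (g := fun x => Real.arcsin (x / 2))
    (by fun_prop) (fun s hs => hasDerivAt_arcsin_half hs) fun s _ => by positivity

/-- The density on `[0, 2]`, up to normalisation. -/
noncomputable def baseDensity (q s : ℝ) : ℝ := √(4 - s ^ 2) / ((1 + q) ^ 2 - q * s ^ 2)

theorem measurable_baseDensity (q : ℝ) : Measurable (baseDensity q) := by
  unfold baseDensity
  fun_prop

theorem baseDensity_nonneg {q s : ℝ} (hq : 0 ≤ q) (hs : s ^ 2 ≤ 4) : 0 ≤ baseDensity q s :=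
  div_nonneg (Real.sqrt_nonneg _)
    ((mul_nonneg hq (by linarith)).trans (mul_four_sub_sq_le q s))

theorem intervalIntegrable_baseDensity {q : ℝ} (hq : 0 ≤ q) :
    IntervalIntegrable (baseDensity q) volume 0 2 := by
  rcases hq.eq_or_lt with rfl | hq'
  · apply Continuous.intervalIntegrable
    unfold baseDensity
    simp only [zero_mul, sub_zero, add_zero, one_pow, div_one]
    fun_prop
  -- For q = 1 the density equals (4 - s²)^(-1/2), unbounded at 2, so a constant bound would not do.
  refine (intervalIntegrable_inv_sqrt.const_mul q⁻¹).mono_fun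
    (measurable_baseDensity q).aestronglyMeasurable ?_
  rw [uIoc_of_le (by norm_num : (0 : ℝ) ≤ 2)]
  filter_upwards [ae_restrict_mem measurableSet_Ioc] with s hs
  have hs4 : s ^ 2 ≤ 4 := sq_le_four_of_mem_Icc ⟨hs.1.le, hs.2⟩
  rw [Real.norm_of_nonneg (baseDensity_nonneg hq hs4), Real.norm_of_nonneg (by positivity)]
  rcases hs4.eq_or_lt with h | h
  · simp [baseDensity, h]
  have hw : 0 < √(4 - s ^ 2) := Real.sqrt_pos.2 (by linarith)
  rw [baseDensity, div_le_iff₀ (denominator_pos hq h), mul_assoc, mul_comm, mul_assoc,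
    ← div_eq_inv_mul, ← div_eq_mul_inv, div_div, le_div_iff₀ (by positivity)]
  calc √(4 - s ^ 2) * (q * √(4 - s ^ 2)) = √(4 - s ^ 2) ^ 2 * q := by ring
    _ = q * (4 - s ^ 2) := by rw [Real.sq_sqrt (by linarith), mul_comm]
    _ ≤ _ := mul_four_sub_sq_le q s

open Filter Topology in
theorem tendsto_div_sqrt : Tendsto (fun s : ℝ => s / √(4 - s ^ 2)) (𝓝[<] 2) atTop := by
  have h1 : Tendsto (fun s : ℝ => √(4 - s ^ 2)) (𝓝[<] 2) (𝓝[>] 0) := by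
    refine tendsto_nhdsWithin_iff.2 ⟨?_, ?_⟩
    · have : Continuous fun s : ℝ => √(4 - s ^ 2) := by fun_prop
      have h := this.tendsto 2
      norm_num at h
      exact h.mono_left nhdsWithin_le_nhds
    · filter_upwards [Ioo_mem_nhdsLT (by norm_num : (0 : ℝ) < 2)] with s hs
      exact Real.sqrt_pos.2 (by linarith [sq_lt_four_of_mem_Ioo hs])
  have h2 := tendsto_inv_nhdsGT_zero.comp h1
  have h3 : Tendsto (fun s : ℝ => s) (𝓝[<] 2) (𝓝 2) := tendsto_id.mono_left nhdsWithin_le_nhds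
  simpa [Function.comp_def, div_eq_mul_inv] using h3.pos_mul_atTop (by norm_num) h2

-- The sign of κ decides whether the argument tends to -∞, stays 0 or tends to +∞. With κ =
-- (1-q)/(1+q) this is the origin of the threshold |ω| = 1.
open Filter Topology in
theorem tendsto_arctan_mul_div_sqrt (κ : ℝ) :
    Tendsto (fun s : ℝ => Real.arctan (κ * (s / √(4 - s ^ 2)))) (𝓝[<] 2)
      (𝓝 (SignType.sign κ * (Real.pi / 2))) := by
  rcases lt_trichotomy κ 0 with h | rfl | h
  · rw [sign_neg h]
    have := (Real.tendsto_arctan_atBot.mono_right nhdsWithin_le_nhds).comp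
      (tendsto_div_sqrt.const_mul_atTop_of_neg h)
    simpa [Function.comp_def] using this
  · simp
  · rw [sign_pos h]
    have := (Real.tendsto_arctan_atTop.mono_right nhdsWithin_le_nhds).comp
      (tendsto_div_sqrt.const_mul_atTop h)
    simpa [Function.comp_def] using this

theorem hasDerivAt_div_sqrt {s : ℝ} (hs : s ^ 2 < 4) :
    HasDerivAt (fun s : ℝ => s / √(4 - s ^ 2)) (4 / √(4 - s ^ 2) ^ 3) s := by
  have hw : 0 < √(4 - s ^ 2) := Real.sqrt_pos.2 (by linarith)
  have h1 : HasDerivAt (fun s : ℝ => 4 - s ^ 2) (-(2 * s)) s := by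
    simpa using (hasDerivAt_pow 2 s).const_sub 4
  have h2 := h1.sqrt (by linarith)
  refine ((hasDerivAt_id s).div h2 hw.ne').congr_deriv ?_
  have hsq := Real.sq_sqrt (show 0 ≤ 4 - s ^ 2 by linarith)
  simp only [id]
  field_simp
  linarith

/-- The mass of the absolutely continuous part, up to normalisation. -/
theorem integral_baseDensity {q : ℝ} (hq : 0 ≤ q) :
    ∫ s in (0 : ℝ)..2, baseDensity q s =
      Real.pi / (1 + q) * (1 - if 1 < q then (q - 1) / q else 0) := by
  rcases hq.eq_or_lt with rfl | hq
  · have h := integral_chebyshevS_mul_sqrt 0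
    simpa [baseDensity] using h
  set κ : ℝ := (1 - q) / (1 + q) with hκ
  -- From D = q(4 - s²) + (1-q)², the integrand is q⁻¹ times (4 - s²)^(-1/2) - (1-q)²/(D√(4 - s²));
  -- the two terms integrate to the arcsine and the arctangent.
  have hderiv : ∀ s ∈ Ioo (0 : ℝ) 2, HasDerivAt
      (fun s => q⁻¹ * (Real.arcsin (s / 2) - κ * Real.arctan (κ * (s / √(4 - s ^ 2)))))
      (baseDensity q s) s := by
    intro s hs
    have hs4 := sq_lt_four_of_mem_Ioo hs
    have hw : 0 < √(4 - s ^ 2) := Real.sqrt_pos.2 (by linarith)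
    have hsq := Real.sq_sqrt (show 0 ≤ 4 - s ^ 2 by linarith)
    have hD := denominator_pos hq.le hs4
    refine (((hasDerivAt_arcsin_half hs).sub
      ((((hasDerivAt_div_sqrt hs4).const_mul κ).arctan).const_mul κ)).const_mul q⁻¹).congr_deriv ?_
    rw [baseDensity]
    have h1 : 1 + (κ * (s / √(4 - s ^ 2))) ^ 2 =
        4 * ((1 + q) ^ 2 - q * s ^ 2) / ((1 + q) ^ 2 * √(4 - s ^ 2) ^ 2) := by
      rw [mul_pow, div_pow s, hsq, hκ]
      have : 4 - s ^ 2 ≠ 0 := by linarith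
      field_simp
      ring
    rw [h1, hκ]
    generalize √(4 - s ^ 2) = w at *
    field_simp
    rw [hsq]
    ring
  have hT := tendsto_arctan_mul_div_sqrt κ
  have hb : Filter.Tendsto
      (fun s => q⁻¹ * (Real.arcsin (s / 2) - κ * Real.arctan (κ * (s / √(4 - s ^ 2)))))
      (nhdsWithin 2 (Iio 2))
      (nhds (q⁻¹ * (Real.pi / 2 - κ * (SignType.sign κ * (Real.pi / 2))))) := by
    refine ((Filter.Tendsto.sub ?_ (hT.const_mul κ))).const_mul _
    have hc : Continuous fun s : ℝ => Real.arcsin (s / 2) := by fun_prop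
    have h := hc.tendsto 2
    norm_num at h
    exact h.mono_left nhdsWithin_le_nhds
  have ha : Filter.Tendsto
      (fun s => q⁻¹ * (Real.arcsin (s / 2) - κ * Real.arctan (κ * (s / √(4 - s ^ 2)))))
      (nhdsWithin 0 (Ioi 0)) (nhds 0) := by
    have hc : ContinuousAt
        (fun s => q⁻¹ * (Real.arcsin (s / 2) - κ * Real.arctan (κ * (s / √(4 - s ^ 2))))) 0 := by
      have : ContinuousAt (fun s : ℝ => s / √(4 - s ^ 2)) 0 :=
        (hasDerivAt_div_sqrt (by norm_num)).continuousAt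
      fun_prop
    have h := hc.tendsto
    norm_num at h
    exact h.mono_left nhdsWithin_le_nhds
  rw [intervalIntegral.integral_eq_sub_of_hasDerivAt_of_tendsto (by norm_num) hderiv
    (intervalIntegrable_baseDensity hq.le) ha hb]
  have hq1 : 0 < 1 + q := by linarith
  -- The boundary values give (π/2q)(1 - |κ|), so only the sign of 1 - q remains to be
  -- distinguished.
  rcases lt_trichotomy q 1 with h | h | h
  · have : 0 < κ := div_pos (by linarith) hq1
    rw [sign_pos this, if_neg (by linarith), hκ]
    simp
    field_simp
    ring
  · have : κ = 0 := by rw [hκ, h]; norm_num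
    rw [this, h]
    norm_num
  · have : κ < 0 := div_neg_of_neg_of_pos (by linarith) hq1
    rw [sign_neg this, if_pos h, hκ]
    simp
    field_simp
    ring

/-! ### The candidate measure -/

/-- The weight of the atom. -/
noncomputable def atomWeight (r : ℝ) : ℝ := if 1 < r then (r ^ 2 - 1) / r ^ 2 else 0

theorem atomWeight_nonneg (r : ℝ) : 0 ≤ atomWeight r := by
  unfold atomWeight
  split_ifs with h
  · exact div_nonneg (by nlinarith) (by positivity)
  · exact le_rfl

/-- The spectral measure of `antiJacobi ω` at `e 0`. -/
noncomputable def spectralMeasure (ω : ℂ) : Measure ℝ :=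
  volume.withDensity (acDensity ω) +
    ENNReal.ofReal (atomWeight ‖ω‖) • Measure.dirac (‖ω‖ + ‖ω‖⁻¹)

theorem acDensity_eq (ω : ℂ) : acDensity ω = fun s => ENNReal.ofReal
    ((Icc (0 : ℝ) 2).indicator
      (fun s => (‖ω‖ ^ 2 + 1) / Real.pi * baseDensity (‖ω‖ ^ 2) s) s) := by
  funext s
  by_cases hs : s ∈ Icc (0 : ℝ) 2 <;> simp [acDensity, hs, baseDensity]

theorem measurable_indicator_density (ω : ℂ) : Measurable
    ((Icc (0 : ℝ) 2).indicator
      (fun s => (‖ω‖ ^ 2 + 1) / Real.pi * baseDensity (‖ω‖ ^ 2) s)) :=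
  ((measurable_baseDensity _).const_mul _).indicator measurableSet_Icc

theorem measurable_acDensity (ω : ℂ) : Measurable (acDensity ω) := by
  rw [acDensity_eq]
  exact (measurable_indicator_density ω).ennreal_ofReal

theorem indicator_density_nonneg (ω : ℂ) (s : ℝ) : 0 ≤ (Icc (0 : ℝ) 2).indicator
    (fun s => (‖ω‖ ^ 2 + 1) / Real.pi * baseDensity (‖ω‖ ^ 2) s) s :=
  indicator_nonneg (fun _ hs => mul_nonneg (by positivity)
    (baseDensity_nonneg (by positivity) (sq_le_four_of_mem_Icc hs))) s

theorem integrable_indicator_density (ω : ℂ) : Integrable ((Icc (0 : ℝ) 2).indicator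
    (fun s => (‖ω‖ ^ 2 + 1) / Real.pi * baseDensity (‖ω‖ ^ 2) s)) := by
  rw [integrable_indicator_iff measurableSet_Icc, integrableOn_Icc_iff_integrableOn_Ioc,
    ← intervalIntegrable_iff_integrableOn_Ioc_of_le (by norm_num)]
  exact (intervalIntegrable_baseDensity (by positivity)).const_mul _

instance isFiniteMeasure_ac (ω : ℂ) : IsFiniteMeasure (volume.withDensity (acDensity ω)) := by
  rw [acDensity_eq]
  exact isFiniteMeasure_withDensity_ofReal (integrable_indicator_density ω).2

instance isFiniteMeasure_spectralMeasure (ω : ℂ) : IsFiniteMeasure (spectralMeasure ω) := by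
  unfold spectralMeasure
  have : IsFiniteMeasure
      (ENNReal.ofReal (atomWeight ‖ω‖) • Measure.dirac (‖ω‖ + ‖ω‖⁻¹) : Measure ℝ) :=
    Measure.smul_finite _ ENNReal.ofReal_ne_top
  infer_instance

/-- A bound for the support of the spectral measure. -/
noncomputable def supportBound (ω : ℂ) : ℝ := 2 + (‖ω‖ + ‖ω‖⁻¹)

theorem ae_mem_ac (ω : ℂ) :
    ∀ᵐ s ∂(volume.withDensity (acDensity ω)), s ∈ Icc (0 : ℝ) 2 := by
  rw [ae_withDensity_iff (measurable_acDensity ω)]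
  refine Filter.Eventually.of_forall fun s hs => ?_
  by_contra h
  exact hs (indicator_of_notMem h _)

theorem ae_mem_support (ω : ℂ) :
    ∀ᵐ s ∂(spectralMeasure ω), s ∈ Icc (0 : ℝ) (supportBound ω) := by
  have h0 : 0 ≤ ‖ω‖ + ‖ω‖⁻¹ := by positivity
  rw [spectralMeasure, ae_add_measure_iff]
  constructor
  · filter_upwards [ae_mem_ac ω] with s hs
    exact ⟨hs.1, by unfold supportBound; linarith [hs.2]⟩
  · refine Measure.ae_smul_measure ?_ _
    rw [ae_dirac_eq]
    exact ⟨h0, by unfold supportBound; linarith⟩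

theorem integrable_of_continuous {E : Type*} [NormedAddCommGroup E] (ω : ℂ) {f : ℝ → E}
    [SecondCountableTopologyEither ℝ E] (hf : Continuous f) : Integrable f (spectralMeasure ω) := by
  obtain ⟨C, hC⟩ := (isCompact_Icc (a := 0) (b := supportBound ω)).exists_bound_of_continuousOn
    hf.continuousOn
  refine Integrable.of_bound hf.aestronglyMeasurable C ?_
  filter_upwards [ae_mem_support ω] with s hs using hC s hs

theorem integral_spectralMeasure (ω : ℂ) {f : ℝ → ℝ} (hf : Continuous f) :
    ∫ s, f s ∂(spectralMeasure ω) =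
      (‖ω‖ ^ 2 + 1) / Real.pi * (∫ s in (0 : ℝ)..2, baseDensity (‖ω‖ ^ 2) s * f s) +
        atomWeight ‖ω‖ * f (‖ω‖ + ‖ω‖⁻¹) := by
  have hint := integrable_of_continuous ω hf
  rw [spectralMeasure, integrable_add_measure] at hint
  rw [spectralMeasure, integral_add_measure hint.1 hint.2, integral_smul_measure, integral_dirac,
    ENNReal.toReal_ofReal (atomWeight_nonneg _), smul_eq_mul, acDensity_eq]
  congr 1
  rw [integral_withDensity_eq_integral_toReal_smul
    (measurable_indicator_density ω).ennreal_ofReal (by simp)]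
  simp only [ENNReal.toReal_ofReal (indicator_density_nonneg ω _), smul_eq_mul]
  rw [intervalIntegral.integral_of_le (by norm_num), ← integral_Icc_eq_integral_Ioc,
    ← integral_const_mul, ← integral_indicator measurableSet_Icc]
  refine integral_congr_ae (Filter.Eventually.of_forall fun s => ?_)
  by_cases hs : s ∈ Icc (0 : ℝ) 2 <;> simp [hs, mul_assoc]

theorem one_lt_sq_iff_norm (ω : ℂ) : 1 < ‖ω‖ ^ 2 ↔ 1 < ‖ω‖ := by
  rw [one_lt_sq_iff₀ (norm_nonneg _)]

theorem integral_one_spectralMeasure (ω : ℂ) : ∫ _, (1 : ℝ) ∂(spectralMeasure ω) = 1 := by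
  have h1 : (0 : ℝ) < 1 + ‖ω‖ ^ 2 := by positivity
  rw [integral_spectralMeasure ω continuous_const]
  simp only [mul_one]
  rw [integral_baseDensity (by positivity)]
  simp only [one_lt_sq_iff_norm, atomWeight]
  have := Real.pi_pos.ne'
  field_simp
  ring

instance isProbabilityMeasure_spectralMeasure (ω : ℂ) :
    IsProbabilityMeasure (spectralMeasure ω) := by
  have h := integral_one_spectralMeasure ω
  rw [integral_const, smul_eq_mul, mul_one] at h
  exact ⟨by rwa [← ENNReal.toReal_eq_one_iff]⟩

/-! ### Chebyshev moments of the candidate measure -/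

/-- The denominator of the density times the spectral measure is the semicircle law. -/
theorem integral_denominator_mul (ω : ℂ) {f : ℝ → ℝ} (hf : Continuous f) :
    ∫ s, ((1 + ‖ω‖ ^ 2) ^ 2 - ‖ω‖ ^ 2 * s ^ 2) * f s ∂(spectralMeasure ω) =
      (‖ω‖ ^ 2 + 1) / Real.pi * ∫ s in (0 : ℝ)..2, f s * √(4 - s ^ 2) := by
  rw [integral_spectralMeasure ω (by fun_prop)]
  -- The atom sits at a zero of the denominator: r(r + 1/r) = 1 + r².
  have hatom : atomWeight ‖ω‖ * (((1 + ‖ω‖ ^ 2) ^ 2 - ‖ω‖ ^ 2 * (‖ω‖ + ‖ω‖⁻¹) ^ 2) *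
      f (‖ω‖ + ‖ω‖⁻¹)) = 0 := by
    unfold atomWeight
    split_ifs with h
    · have h0 : ‖ω‖ ≠ 0 := by linarith
      have : (1 + ‖ω‖ ^ 2) ^ 2 - ‖ω‖ ^ 2 * (‖ω‖ + ‖ω‖⁻¹) ^ 2 = 0 := by
        field_simp
        ring
      rw [this]
      ring
    · ring
  rw [hatom, add_zero]
  congr 1
  -- The endpoint 2 is discarded because the denominator vanishes there when q = 1.
  rw [intervalIntegral.integral_of_le (by norm_num), intervalIntegral.integral_of_le (by norm_num),
    integral_Ioc_eq_integral_Ioo, integral_Ioc_eq_integral_Ioo]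
  refine setIntegral_congr_fun measurableSet_Ioo fun s hs => ?_
  have hD := denominator_pos (q := ‖ω‖ ^ 2) (by positivity) (sq_lt_four_of_mem_Ioo hs)
  rw [baseDensity, ← mul_assoc, div_mul_cancel₀ _ hD.ne', mul_comm]

open Polynomial in
/-- The integrals of the even Chebyshev polynomials against the spectral measure. -/
theorem integral_chebyshevS (ω : ℂ) (k : ℕ) :
    ∫ s, (Chebyshev.S ℝ (2 * k)).eval s ∂(spectralMeasure ω) = (‖ω‖ ^ 2) ^ k := by
  set q := ‖ω‖ ^ 2 with hq
  set c : ℤ → ℝ := fun n => ∫ s, (Chebyshev.S ℝ (2 * n)).eval s ∂(spectralMeasure ω) with hc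
  have hint : ∀ n : ℤ, Integrable (fun s => (Chebyshev.S ℝ n).eval s) (spectralMeasure ω) :=
    fun n => integrable_of_continuous ω (Polynomial.continuous _)
  have hrec : ∀ k : ℕ, (1 + q ^ 2) * c k - q * c (k + 1) - q * c (k - 1) =
      if k = 0 then 1 + q else 0 := by
    intro k
    have h := integral_denominator_mul ω (Polynomial.continuous (Chebyshev.S ℝ (2 * k)))
    rw [integral_chebyshevS_mul_sqrt, ← hq] at h
    -- This is s² S_{2k} = S_{2k+2} + 2 S_{2k} + S_{2k-2}.
    have hpt : ∀ s : ℝ, ((1 + q) ^ 2 - q * s ^ 2) * (Chebyshev.S ℝ (2 * k)).eval s =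
        (1 + q ^ 2) * (Chebyshev.S ℝ (2 * k)).eval s -
          q * (Chebyshev.S ℝ (2 * (k + 1))).eval s -
          q * (Chebyshev.S ℝ (2 * (k - 1))).eval s := by
      intro s
      have e1 := congrArg (eval s) (Chebyshev.S_add_two ℝ (2 * k))
      have e2 := congrArg (eval s) (Chebyshev.S_sub_two ℝ (2 * k))
      have e3 := congrArg (eval s) (Chebyshev.S_add_one ℝ (2 * k))
      simp only [eval_sub, eval_mul, eval_X] at e1 e2 e3
      rw [show (2 * ((k : ℤ) + 1)) = 2 * k + 2 by ring,
        show (2 * ((k : ℤ) - 1)) = 2 * k - 2 by ring, e1, e2, e3]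
      ring
    simp only [hpt] at h
    rw [integral_sub (by exact ((hint _).const_mul _).sub ((hint _).const_mul _))
        ((hint _).const_mul _),
      integral_sub ((hint _).const_mul _) ((hint _).const_mul _), integral_const_mul,
      integral_const_mul, integral_const_mul] at h
    rw [hc]
    simp only
    rw [h]
    split_ifs
    · have := Real.pi_pos.ne'
      field_simp
      ring
    · simp
  have h0 : c 0 = 1 := by simp [hc]
  -- The recurrence at k = 0 reaches index -1, where S_{-2} = -S_0; hence c 0 alone starts the
  -- induction.
  have hneg : c (-1) = -1 := by
    have : c (-1) = -c 0 := by
      simp only [hc, mul_neg, mul_one, mul_zero, Chebyshev.S_neg_two, Chebyshev.S_zero, eval_neg,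
        integral_neg]
    rw [this, h0]
  -- For q = 0 the recurrence loses its neighbours and gives c k outright; otherwise it can be
  -- solved for c (k + 1).
  rcases (sq_nonneg ‖ω‖).eq_or_lt with hq0 | hq0
  · have hq0' : q = 0 := hq0.symm
    have h := hrec k
    simp only [hq0'] at h
    change c k = _
    rw [hq0', zero_pow_eq]
    simpa using h
  · have hstep : ∀ k : ℕ, c k = q ^ k ∧ c (k + 1) = q ^ (k + 1) := by
      have hqne : q ≠ 0 := hq0.ne'
      intro k
      induction k with
      | zero =>
        refine ⟨by simpa using h0, ?_⟩
        have h := hrec 0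
        simp only [Nat.cast_zero, zero_add, zero_sub, h0, hneg, if_true] at h
        simp only [Nat.cast_zero, zero_add, pow_one]
        apply mul_left_cancel₀ hqne
        linarith
      | succ k ih =>
        refine ⟨by exact_mod_cast ih.2, ?_⟩
        have h := hrec (k + 1)
        simp only [Nat.cast_add, Nat.cast_one, add_sub_cancel_right, ih.1, ih.2,
          Nat.add_eq_zero_iff, one_ne_zero, and_false, if_false] at h
        apply mul_left_cancel₀ hqne
        push_cast
        linear_combination -h
    exact (hstep k).1

/-! ### Functional calculus of the modulus -/

section FunctionalCalculus

variable {H : Type*} [NormedAddCommGroup H] [InnerProductSpace ℂ H] [CompleteSpace H]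

theorem modulus_nonneg (B : H →L⋆[ℂ] H) : 0 ≤ modulus B := CFC.sqrt_nonneg _

theorem modulus_sq {B : H →L⋆[ℂ] H} (hB : IsSymm B) : modulus B ^ 2 = sq B :=
  CFC.sq_sqrt _ ((ContinuousLinearMap.nonneg_iff_isPositive _).2 hB.isPositive_sq)

theorem isStarNormal_modulus (B : H →L⋆[ℂ] H) : IsStarNormal (modulus B) :=
  (IsSelfAdjoint.of_nonneg (modulus_nonneg B)).isStarNormal

theorem spectrum_modulus (B : H →L⋆[ℂ] H) {z : ℂ} (hz : z ∈ spectrum ℂ (modulus B)) :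
    z = (z.re : ℂ) ∧ z.re ∈ Icc (0 : ℝ) ‖modulus B‖ := by
  have hre := (IsSelfAdjoint.of_nonneg (modulus_nonneg B)).mem_spectrum_eq_re hz
  refine ⟨hre, ?_, ?_⟩
  · have h : z.re ∈ spectrum ℝ (modulus B) := by
      rw [← spectrum.preimage_algebraMap ℂ]
      change ((z.re : ℝ) : ℂ) ∈ spectrum ℂ (modulus B)
      rwa [← hre]
    exact spectrum_nonneg_of_nonneg (modulus_nonneg B) h
  · cases subsingleton_or_nontrivial H
    · rw [Subsingleton.elim (modulus B) 0] at hz ⊢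
      simp [spectrum.of_subsingleton] at hz
    · exact (Complex.re_le_norm z).trans (spectrum.norm_le_norm_of_mem hz)

-- Only even powers of |B| are directly accessible, through |B|² = B². The real part in `funModulus`
-- is harmless because the spectrum is real.
open Polynomial in
theorem funModulus_polynomial {B : H →L⋆[ℂ] H} (hB : IsSymm B) (p : ℂ[X]) :
    funModulus B (fun s => p.eval ((s : ℂ) ^ 2)) = aeval (sq B) p := by
  have hn := isStarNormal_modulus B
  rw [funModulus, ← modulus_sq hB]
  have h : cfc (fun z : ℂ => p.eval ((z.re : ℂ) ^ 2)) (modulus B) =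
      cfc (p.comp (X ^ 2)).eval (modulus B) := by
    refine cfc_congr fun z hz => ?_
    simp only [eval_comp, eval_pow, eval_X]
    rw [← (spectrum_modulus B hz).1]
  rw [h, cfc_polynomial _ _ hn, aeval_comp, map_pow, aeval_X]

theorem norm_funModulus_sub_le {B : H →L⋆[ℂ] H} {f g : ℝ → ℂ} (hf : Continuous f)
    (hg : Continuous g) {ε : ℝ} (hε : 0 ≤ ε) (h : ∀ s ∈ Icc 0 ‖modulus B‖, ‖f s - g s‖ ≤ ε) :
    ‖funModulus B f - funModulus B g‖ ≤ ε := by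
  have hn := isStarNormal_modulus B
  rw [funModulus, funModulus, ← cfc_sub (fun z : ℂ => f z.re) (fun z : ℂ => g z.re) (modulus B)]
  exact norm_cfc_le hε fun z hz => h _ (spectrum_modulus B hz).2

open Polynomial in
/-- Continuous functions are uniformly approximated on `[0, R]` by polynomials in `s²`. -/
theorem exists_polynomial_sq_near {f : ℝ → ℂ} (hf : Continuous f) {R ε : ℝ} (hε : 0 < ε) :
    ∃ p : ℂ[X], ∀ s ∈ Icc (0 : ℝ) R, ‖f s - p.eval ((s : ℂ) ^ 2)‖ ≤ ε := by
  -- Weierstrass approximation of t ↦ f(√t), real and imaginary parts separately; on s ≥ 0 the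
  -- substitution t = s² recovers f.
  obtain ⟨p, hp⟩ := exists_polynomial_near_of_continuousOn 0 (R ^ 2) (fun t => (f √t).re)
    (by fun_prop) (ε / 2) (by positivity)
  obtain ⟨q, hq⟩ := exists_polynomial_near_of_continuousOn 0 (R ^ 2) (fun t => (f √t).im)
    (by fun_prop) (ε / 2) (by positivity)
  refine ⟨p.map (algebraMap ℝ ℂ) + C Complex.I * q.map (algebraMap ℝ ℂ), fun s hs => ?_⟩
  have hs2 : s ^ 2 ∈ Icc 0 (R ^ 2) := ⟨by positivity, pow_le_pow_left₀ hs.1 hs.2 2⟩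
  have h1 := hp _ hs2
  have h2 := hq _ hs2
  rw [Real.sqrt_sq hs.1, abs_sub_comm] at h1 h2
  have hev : ∀ r : ℝ[X], (r.map (algebraMap ℝ ℂ)).eval ((s : ℂ) ^ 2) = (r.eval (s ^ 2) : ℝ) := by
    intro r
    rw [← Complex.ofReal_pow, eval_map_algebraMap]
    exact aeval_algebraMap_apply_eq_algebraMap_eval (A := ℂ) (s ^ 2) r
  rw [eval_add, eval_mul, eval_C, hev, hev]
  refine (Complex.norm_le_abs_re_add_abs_im _).trans ?_
  simp
  linarith

open Polynomial in
/-- If the even moments of `φ ν` are the matrix elements of the powers of `B²`, then the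
functional calculus of `|B|` is integration against `φ ν`. -/
theorem inner_funModulus_eq_integral {B : H →L⋆[ℂ] H} (hB : IsSymm B) {x y : H} {ν : Measure ℝ}
    {R : ℝ} (hR : ∀ᵐ s ∂ν, s ∈ Icc 0 R) {φ : ℝ → ℂ}
    (hφ : ∀ f : ℝ → ℂ, Continuous f → Integrable (fun s => f s * φ s) ν)
    (hmom : ∀ k : ℕ, ⟪y, (sq B ^ k) x⟫_ℂ = ∫ s, ((s : ℂ) ^ 2) ^ k * φ s ∂ν)
    {f : ℝ → ℂ} (hf : Continuous f) :
    ⟪y, funModulus B f x⟫_ℂ = ∫ s, f s * φ s ∂ν := by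
  have hpoly : ∀ p : ℂ[X], ⟪y, aeval (sq B) p x⟫_ℂ = ∫ s, p.eval ((s : ℂ) ^ 2) * φ s ∂ν := by
    intro p
    induction p using Polynomial.induction_on' with
    | add p q hp hq =>
      simp only [map_add, _root_.add_apply, inner_add_right, hp, hq, eval_add, add_mul]
      rw [integral_add (hφ _ (by fun_prop)) (hφ _ (by fun_prop))]
    | monomial k a =>
      simp only [aeval_monomial, eval_monomial, mul_assoc]
      rw [integral_const_mul, ← hmom, ← Algebra.smul_def, _root_.smul_apply,
        inner_smul_right]
  have hφ1 : Integrable φ ν := by simpa using hφ (fun _ => 1) continuous_const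
  set M : ℝ := ‖y‖ * ‖x‖ + ∫ s, ‖φ s‖ ∂ν with hM
  have hM0 : 0 ≤ M := by positivity
  have hbound : ∀ ε > 0, ‖⟪y, funModulus B f x⟫_ℂ - ∫ s, f s * φ s ∂ν‖ ≤ ε * M := by
    intro ε hε
    -- One interval must contain both the support of ν and the spectrum of |B|.
    obtain ⟨p, hp⟩ := exists_polynomial_sq_near hf (R := max R ‖modulus B‖) hε
    have hpc : Continuous fun s : ℝ => p.eval ((s : ℂ) ^ 2) := by fun_prop
    have h1 : ‖⟪y, funModulus B f x⟫_ℂ - ⟪y, aeval (sq B) p x⟫_ℂ‖ ≤ ε * (‖y‖ * ‖x‖) := by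
      rw [← inner_sub_right, ← _root_.sub_apply, ← funModulus_polynomial hB p]
      refine (norm_inner_le_norm _ _).trans ?_
      have h := norm_funModulus_sub_le (B := B) hf hpc hε.le
        fun s hs => hp s ⟨hs.1, hs.2.trans (le_max_right _ _)⟩
      have h' := ContinuousLinearMap.le_of_opNorm_le _ h x
      calc _ ≤ ‖y‖ * (ε * ‖x‖) := by gcongr
        _ = _ := by ring
    have h2 : ‖∫ s, p.eval ((s : ℂ) ^ 2) * φ s ∂ν - ∫ s, f s * φ s ∂ν‖ ≤ ε * ∫ s, ‖φ s‖ ∂ν := by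
      rw [← integral_sub (hφ _ hpc) (hφ _ hf), ← integral_const_mul]
      refine norm_integral_le_of_norm_le (hφ1.norm.const_mul ε) ?_
      filter_upwards [hR] with s hs
      rw [← sub_mul, norm_mul, norm_sub_rev]
      gcongr
      exact hp s ⟨hs.1, hs.2.trans (le_max_left _ _)⟩
    rw [hpoly] at h1
    calc _ ≤ _ := norm_sub_le_norm_sub_add_norm_sub _ (∫ s, p.eval ((s : ℂ) ^ 2) * φ s ∂ν) _
      _ ≤ ε * (‖y‖ * ‖x‖) + ε * ∫ s, ‖φ s‖ ∂ν := add_le_add h1 h2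
      _ = ε * M := by rw [hM]; ring
  rw [← sub_eq_zero, ← norm_le_zero_iff]
  refine le_of_forall_pos_le_add fun ε hε => ?_
  -- M may be zero, hence the division by M + 1.
  refine (hbound (ε / (M + 1)) (by positivity)).trans ?_
  rw [zero_add, div_mul_eq_mul_div, div_le_iff₀ (by positivity)]
  nlinarith

end FunctionalCalculus

/-! ### Moments of the anti-linear Jacobi operator -/

section Moments

open Polynomial

/-- The spectral measure at `e 0` of the Jacobi matrix with real parameter `‖ω‖`, as a functional
on polynomials. -/
noncomputable def jacobiFunctional (ω : ℂ) (p : ℝ[X]) : ℝ :=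
  ∫ s, ((1 + ‖ω‖ / (1 + ‖ω‖ ^ 2) * s) * p.eval s +
    (1 - ‖ω‖ / (1 + ‖ω‖ ^ 2) * s) * p.eval (-s)) / 2 ∂(spectralMeasure ω)

theorem jacobiFunctional_add (ω : ℂ) (p q : ℝ[X]) :
    jacobiFunctional ω (p + q) = jacobiFunctional ω p + jacobiFunctional ω q := by
  unfold jacobiFunctional
  rw [← integral_add (integrable_of_continuous ω (by fun_prop))
    (integrable_of_continuous ω (by fun_prop))]
  congr 1
  funext s
  simp only [eval_add]
  ring

theorem jacobiFunctional_C_mul (ω : ℂ) (a : ℝ) (p : ℝ[X]) :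
    jacobiFunctional ω (C a * p) = a * jacobiFunctional ω p := by
  unfold jacobiFunctional
  rw [← integral_const_mul]
  congr 1
  funext s
  simp only [eval_mul, eval_C]
  ring

theorem jacobiFunctional_even (ω : ℂ) {p : ℝ[X]} (hp : ∀ s, p.eval (-s) = p.eval s) :
    jacobiFunctional ω p = ∫ s, p.eval s ∂(spectralMeasure ω) := by
  unfold jacobiFunctional
  congr 1
  funext s
  rw [hp]
  ring

theorem jacobiFunctional_odd (ω : ℂ) {p : ℝ[X]} (hp : ∀ s, p.eval (-s) = -p.eval s) :
    jacobiFunctional ω p =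
      ‖ω‖ / (1 + ‖ω‖ ^ 2) * ∫ s, s * p.eval s ∂(spectralMeasure ω) := by
  unfold jacobiFunctional
  rw [← integral_const_mul]
  congr 1
  funext s
  rw [hp]
  ring

theorem chebyshevS_eval_neg (k : ℕ) (s : ℝ) :
    (Chebyshev.S ℝ (2 * k)).eval (-s) = (Chebyshev.S ℝ (2 * k)).eval s ∧
      (Chebyshev.S ℝ (2 * k + 1)).eval (-s) = -(Chebyshev.S ℝ (2 * k + 1)).eval s := by
  induction k with
  | zero => simp
  | succ k ih =>
    have e1 : ∀ t, (Chebyshev.S ℝ (2 * (k + 1 : ℕ))).eval t =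
        t * (Chebyshev.S ℝ (2 * k + 1)).eval t - (Chebyshev.S ℝ (2 * k)).eval t := by
      intro t
      have h := congrArg (eval t) (Chebyshev.S_add_two ℝ (2 * k))
      simp only [eval_sub, eval_mul, eval_X] at h
      rw [← h]
      congr 2
    have e2 : ∀ t, (Chebyshev.S ℝ (2 * (k + 1 : ℕ) + 1)).eval t =
        t * (Chebyshev.S ℝ (2 * (k + 1 : ℕ))).eval t - (Chebyshev.S ℝ (2 * k + 1)).eval t := by
      intro t
      have h := congrArg (eval t) (Chebyshev.S_add_one ℝ (2 * (k + 1 : ℕ)))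
      simp only [eval_sub, eval_mul, eval_X] at h
      rw [h]
      congr 4
      push_cast
      ring
    have h1 : (Chebyshev.S ℝ (2 * (k + 1 : ℕ))).eval (-s) =
        (Chebyshev.S ℝ (2 * (k + 1 : ℕ))).eval s := by
      rw [e1, e1, ih.1, ih.2]
      ring
    refine ⟨h1, ?_⟩
    rw [e2, e2, h1, ih.2]
    ring

/-- For even n this is the moment formula of ν. For odd n, s S_{2k+1} = S_{2k+2} + S_{2k} integrates
to (1 + r²) r^{2k}, and the factor r/(1 + r²) turns this into r^{2k+1}. -/
theorem jacobiFunctional_chebyshevS (ω : ℂ) (n : ℕ) :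
    jacobiFunctional ω (Chebyshev.S ℝ n) = ‖ω‖ ^ n := by
  obtain ⟨k, rfl | rfl⟩ := n.even_or_odd'
  · push_cast
    rw [jacobiFunctional_even ω fun s => (chebyshevS_eval_neg k s).1, integral_chebyshevS,
      pow_mul]
  · push_cast
    rw [jacobiFunctional_odd ω fun s => (chebyshevS_eval_neg k s).2]
    have hpt : ∀ s : ℝ, s * (Chebyshev.S ℝ (2 * k + 1)).eval s =
        (Chebyshev.S ℝ (2 * (k + 1 : ℕ))).eval s + (Chebyshev.S ℝ (2 * k)).eval s := by
      intro s
      have h := congrArg (eval s) (Chebyshev.S_add_two ℝ (2 * k))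
      simp only [eval_sub, eval_mul, eval_X] at h
      rw [show (2 * ((k + 1 : ℕ) : ℤ)) = 2 * k + 2 by push_cast; ring, h]
      ring
    simp only [hpt]
    rw [integral_add (integrable_of_continuous ω (by fun_prop))
      (integrable_of_continuous ω (by fun_prop)), integral_chebyshevS, integral_chebyshevS]
    have : (1 + ‖ω‖ ^ 2) ≠ 0 := by positivity
    field_simp
    ring

/-- The orthogonal polynomials of the Jacobi matrix with real parameter `r`. -/
noncomputable def jacobiPolynomial (r : ℝ) (n : ℕ) : ℝ[X] :=
  Chebyshev.S ℝ n - C r * Chebyshev.S ℝ (n - 1)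

/-- The index n - 1 is an integer, and S_{-1} = 0 makes the zeroth polynomial 1; the corner entry r
then appears in this relation only. -/
theorem X_mul_jacobiPolynomial_zero (r : ℝ) :
    X * jacobiPolynomial r 0 = jacobiPolynomial r 1 + C r * jacobiPolynomial r 0 := by
  simp [jacobiPolynomial]

theorem X_mul_jacobiPolynomial_succ (r : ℝ) (n : ℕ) :
    X * jacobiPolynomial r (n + 1) = jacobiPolynomial r n + jacobiPolynomial r (n + 2) := by
  simp only [jacobiPolynomial]
  have h1 := Chebyshev.S_add_two ℝ n
  have h2 := Chebyshev.S_add_one ℝ n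
  push_cast
  rw [show (n : ℤ) + 2 - 1 = n + 1 by ring, show (n : ℤ) + 1 - 1 = n by ring, h1, h2]
  ring

/-- For n ≥ 1 the value is r^n - r · r^{n-1}. This matches the pairing of e 0 with e n and is the
base case of the moment induction. -/
theorem jacobiFunctional_jacobiPolynomial (ω : ℂ) (n : ℕ) :
    jacobiFunctional ω (jacobiPolynomial ‖ω‖ n) = if n = 0 then 1 else 0 := by
  cases n with
  | zero =>
    have h := jacobiFunctional_chebyshevS ω 0
    simpa [jacobiPolynomial] using h
  | succ n =>
    have hn : jacobiPolynomial ‖ω‖ (n + 1) =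
        Chebyshev.S ℝ (n + 1 : ℕ) + C (-‖ω‖) * Chebyshev.S ℝ n := by
      simp [jacobiPolynomial, sub_eq_add_neg]
    rw [hn, jacobiFunctional_add, jacobiFunctional_C_mul, jacobiFunctional_chebyshevS,
      jacobiFunctional_chebyshevS]
    simp
    ring

/-- The phase of `ω`. -/
noncomputable def phase (ω : ℂ) : ℂ := if ω = 0 then 1 else ω / ‖ω‖

theorem norm_mul_phase (ω : ℂ) : (‖ω‖ : ℂ) * phase ω = ω := by
  unfold phase
  split_ifs with h
  · simp [h]
  · rw [mul_div_cancel₀]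
    simpa using h

/-- The value 1 assigned at ω = 0 keeps the phase unimodular without exception. -/
theorem conj_phase_mul (ω : ℂ) : starRingEnd ℂ (phase ω) * phase ω = 1 := by
  rw [Complex.conj_mul']
  unfold phase
  split_ifs with h
  · simp
  · simp [h]

theorem antiJacobi_apply (ω : ℂ) (x : L2N) : antiJacobi ω x = jacobi ω (conjL2 x) := rfl

theorem conjL2_e (n : ℕ) : conjL2 (e n) = e n := by
  ext k
  rw [conjL2_apply]
  by_cases h : k = n <;> simp [e, h]

theorem antiJacobi_e_zero (ω : ℂ) : antiJacobi ω (e 0) = ω • e 0 + e 1 := by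
  rw [antiJacobi_apply, conjL2_e]
  ext k
  simp only [lp.coeFn_add, lp.coeFn_smul, Pi.add_apply, Pi.smul_apply]
  rcases k with _ | k
  · rw [(jacobi_apply ω _).1]; simp [e]
  · rw [(jacobi_apply ω _).2]; simp [e, Pi.single_apply]

theorem antiJacobi_e_succ (ω : ℂ) (n : ℕ) : antiJacobi ω (e (n + 1)) = e n + e (n + 2) := by
  rw [antiJacobi_apply, conjL2_e]
  ext k
  simp only [lp.coeFn_add, Pi.add_apply]
  rcases k with _ | k
  · rw [(jacobi_apply ω _).1]; simp [e, Pi.single_apply, eq_comm]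
  · rw [(jacobi_apply ω _).2]
    simp only [e, lp.coeFn_single, Pi.single_apply]
    split_ifs <;> first | omega | simp

theorem iterate_antiLinear_smul {H : Type*} [NormedAddCommGroup H] [InnerProductSpace ℂ H]
    (B : H →L⋆[ℂ] H) (k : ℕ) (c : ℂ) (x : H) :
    B^[k] (c • x) = (if Even k then c else starRingEnd ℂ c) • B^[k] x := by
  induction k with
  | zero => simp
  | succ k ih =>
    rw [Function.iterate_succ_apply', Function.iterate_succ_apply', ih, map_smulₛₗ]
    by_cases h : Even k <;> simp [h, Nat.even_add_one]

/-- Induction on k: applying B to e n and multiplying the n-th polynomial by X follow the same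
recurrence. The corner term carries ω past k conjugations: for even k, ω = r · phase supplies the
new phase; for odd k, conj ω cancels the phase already there and leaves r. -/
theorem inner_iterate_antiJacobi (ω : ℂ) (k n : ℕ) :
    ⟪e 0, (antiJacobi ω)^[k] (e n)⟫_ℂ = (if Even (k + n) then 1 else phase ω) *
      (jacobiFunctional ω (X ^ k * jacobiPolynomial ‖ω‖ n) : ℝ) := by
  induction k generalizing n with
  | zero =>
    rw [Function.iterate_zero, id, pow_zero, one_mul, jacobiFunctional_jacobiPolynomial]
    rcases n with _ | n <;> simp [e, lp.inner_single_left]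
  | succ k ih =>
    rw [Function.iterate_succ_apply, pow_succ, mul_assoc]
    cases n with
    | zero =>
      rw [antiJacobi_e_zero, iterate_map_add, inner_add_right, iterate_antiLinear_smul,
        inner_smul_right, ih, ih, X_mul_jacobiPolynomial_zero, mul_add,
        mul_left_comm (X ^ k) (C ‖ω‖), jacobiFunctional_add, jacobiFunctional_C_mul]
      have h1 := norm_mul_phase ω
      have h2 := conj_phase_mul ω
      have h3 : starRingEnd ℂ ω = ‖ω‖ * starRingEnd ℂ (phase ω) := by
        conv_lhs => rw [← h1]
        simp
      push_cast
      by_cases h : Even k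
      · simp only [h, Nat.even_add_one, add_zero, not_true_eq_false, if_true, if_false]
        linear_combination -(jacobiFunctional ω (X ^ k * jacobiPolynomial ‖ω‖ 0) : ℂ) * h1
      · simp only [h, Nat.even_add_one, add_zero, not_false_eq_true, if_true, if_false, h3]
        linear_combination (‖ω‖ : ℂ) *
          (jacobiFunctional ω (X ^ k * jacobiPolynomial ‖ω‖ 0) : ℂ) * h2
    | succ n =>
      rw [antiJacobi_e_succ, iterate_map_add, inner_add_right, ih, ih,
        X_mul_jacobiPolynomial_succ, mul_add, jacobiFunctional_add]
      have h1 : Even (k + 1 + (n + 1)) ↔ Even (k + n) := by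
        rw [show k + 1 + (n + 1) = k + n + 2 by ring]
        simp [Nat.even_add]
      have h2 : Even (k + (n + 2)) ↔ Even (k + n) := by
        rw [← add_assoc]
        simp [Nat.even_add]
      simp only [h1, h2]
      push_cast
      ring

theorem sq_pow_apply {H : Type*} [NormedAddCommGroup H] [InnerProductSpace ℂ H]
    (B : H →L⋆[ℂ] H) (k : ℕ) (x : H) : (sq B ^ k) x = B^[2 * k] x := by
  induction k with
  | zero => simp
  | succ k ih =>
    rw [pow_succ', mul_apply_eq_comp, ih, mul_add, mul_one,
      Function.iterate_succ_apply', Function.iterate_succ_apply']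
    rfl

theorem inner_sq_pow_antiJacobi (ω : ℂ) (k : ℕ) :
    ⟪e 0, (sq (antiJacobi ω) ^ k) (e 0)⟫_ℂ =
      ∫ s, ((s : ℂ) ^ 2) ^ k * 1 ∂(spectralMeasure ω) := by
  rw [sq_pow_apply, inner_iterate_antiJacobi, jacobiFunctional_even]
  · rw [← integral_complex_ofReal]
    simp [jacobiPolynomial, pow_mul]
  · intro s
    simp [jacobiPolynomial, pow_mul]

/-- The phase function `ψ` of `antiJacobi ω`. -/
noncomputable def phaseFunction (ω : ℂ) (s : ℝ) : ℂ := ω * (s : ℂ) / (1 + (‖ω‖ : ℂ) ^ 2)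

theorem inner_sq_pow_antiJacobi_apply (ω : ℂ) (k : ℕ) :
    ⟪e 0, (sq (antiJacobi ω) ^ k) (antiJacobi ω (e 0))⟫_ℂ =
      ∫ s : ℝ, ((s : ℂ) ^ 2) ^ k * (s * phaseFunction ω s) ∂(spectralMeasure ω) := by
  rw [sq_pow_apply, ← Function.iterate_succ_apply, inner_iterate_antiJacobi, jacobiFunctional_odd]
  · rw [if_neg (by simp), Complex.ofReal_mul, ← integral_complex_ofReal,
      ← integral_const_mul, ← integral_const_mul]
    congr 1
    funext s
    simp only [phaseFunction]
    have h := norm_mul_phase ω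
    simp [jacobiPolynomial, pow_mul, pow_succ]
    linear_combination ((s : ℂ) ^ 2) ^ k * s ^ 2 * (1 + (‖ω‖ : ℂ) ^ 2)⁻¹ * h
  · intro s
    simp [jacobiPolynomial, pow_mul, pow_succ]

end Moments

/-! ### The candidate is spectral data -/

theorem continuous_phaseFunction (ω : ℂ) : Continuous (phaseFunction ω) := by
  unfold phaseFunction
  fun_prop

theorem isSpectralData_spectralMeasure (ω : ℂ) :
    IsSpectralData (antiJacobi ω) (e 0) (spectralMeasure ω) (phaseFunction ω) where
  isProbabilityMeasure := inferInstance
  measure_Iio := by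
    refine measure_mono_null (fun s hs => ?_) (ae_iff.1 (ae_mem_support ω))
    exact fun h => absurd hs (not_lt.2 h.1)
  memLp_phase := by
    obtain ⟨C, hC⟩ := (isCompact_Icc (a := 0) (b := supportBound ω)).exists_bound_of_continuousOn
      (continuous_phaseFunction ω).continuousOn
    refine memLp_top_of_bound (continuous_phaseFunction ω).aestronglyMeasurable C ?_
    filter_upwards [(withDensity_absolutelyContinuous _ _).ae_le (ae_mem_support ω)] with s hs
      using hC s hs
  integrable_measure f hf := integrable_of_continuous ω hf
  inner_measure f hf := by
    have h := inner_funModulus_eq_integral (antiJacobi_isSymm ω) (ae_mem_support ω)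
      (φ := fun _ => 1) (fun f hf => integrable_of_continuous ω (by fun_prop))
      (inner_sq_pow_antiJacobi ω) hf
    simpa using h
  integrable_phase f hf := by
    have := continuous_phaseFunction ω
    exact integrable_of_continuous ω (by fun_prop)
  inner_phase f hf := by
    have hc := continuous_phaseFunction ω
    rw [inner_funModulus_eq_integral (antiJacobi_isSymm ω) (ae_mem_support ω)
      (φ := fun s => s * phaseFunction ω s) (fun f hf => integrable_of_continuous ω (by fun_prop))
      (inner_sq_pow_antiJacobi_apply ω) hf]
    congr 1
    funext s
    ring

/-! ### Uniqueness of spectral data -/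

section Uniqueness

variable {H : Type*} [NormedAddCommGroup H] [InnerProductSpace ℂ H] [CompleteSpace H]
  {B : H →L⋆[ℂ] H} {δ : H} {ν ν' : Measure ℝ} {ψ ψ' : ℝ → ℂ}

theorem IsSpectralData.measure_unique (h : IsSpectralData B δ ν ψ)
    (h' : IsSpectralData B δ ν' ψ') : ν = ν' := by
  have := h.isProbabilityMeasure
  have := h'.isProbabilityMeasure
  refine ext_of_forall_integral_eq_of_IsFiniteMeasure fun f => ?_
  have hf : Continuous fun s => (f s : ℂ) := by fun_prop
  have heq := (h.inner_measure _ hf).symm.trans (h'.inner_measure _ hf)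
  rw [integral_complex_ofReal, integral_complex_ofReal] at heq
  exact_mod_cast heq

/-- The data only see s ψ(s), a ν-integrable function determined by its integrals against smooth
test functions; nothing is learned about ψ at 0. -/
theorem IsSpectralData.phase_unique (h : IsSpectralData B δ ν ψ)
    (h' : IsSpectralData B δ ν ψ') : ∀ᵐ s ∂ν, s ≠ 0 → ψ s = ψ' s := by
  have hint := h.integrable_phase (fun _ => 1) continuous_const
  have hint' := h'.integrable_phase (fun _ => 1) continuous_const
  have hz := ae_eq_zero_of_integral_contDiff_smul_eq_zero (hint.sub hint').locallyIntegrable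
    fun g hg _ => ?_
  · filter_upwards [hz] with s hs hs0
    simp only [Pi.sub_apply, mul_one, ← mul_sub, mul_eq_zero, Complex.ofReal_eq_zero, hs0,
      false_or] at hs
    exact sub_eq_zero.1 hs
  · have hgc : Continuous fun s => (g s : ℂ) := Complex.continuous_ofReal.comp hg.continuous
    have heq := (h.inner_phase _ hgc).symm.trans (h'.inner_phase _ hgc)
    rw [← sub_eq_zero, ← integral_sub (h.integrable_phase _ hgc) (h'.integrable_phase _ hgc)] at heq
    rw [← heq]
    congr 1
    funext s
    simp only [Pi.sub_apply, mul_one, Complex.real_smul]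
    ring

end Uniqueness

/-! ### Null sets and Lebesgue decomposition -/

theorem ae_ne_zero (ω : ℂ) : ∀ᵐ s ∂(spectralMeasure ω), s ≠ 0 := by
  rw [spectralMeasure, ae_add_measure_iff]
  refine ⟨(withDensity_absolutelyContinuous _ _).ae_le (Measure.ae_ne volume 0), ?_⟩
  by_cases h : 1 < ‖ω‖
  · refine Measure.ae_smul_measure ?_ _
    rw [ae_dirac_eq]
    exact (by positivity : (0 : ℝ) < ‖ω‖ + ‖ω‖⁻¹).ne'
  -- For ω = 0 the convention 0⁻¹ = 0 places the point mass at 0, but its weight is zero.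
  · simp [atomWeight, h]

theorem atomWeight_pos {r : ℝ} (hr : 1 < r) : 0 < atomWeight r := by
  rw [atomWeight, if_pos hr]
  exact div_pos (by nlinarith) (by positivity)

/-- A point of positive mass lies in no null set, so the almost-everywhere formula for ψ holds at
the atom itself. -/
theorem of_ae_spectralMeasure {ω : ℂ} (hω : 1 < ‖ω‖) {p : ℝ → Prop}
    (hp : ∀ᵐ s ∂(spectralMeasure ω), p s) : p (‖ω‖ + ‖ω‖⁻¹) := by
  rw [spectralMeasure, ae_add_measure_iff,
    Measure.ae_ennreal_smul_measure_iff (by simpa using atomWeight_pos hω), ae_dirac_eq] at hp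
  exact hp.2

theorem spectralMeasure_singularPart (ω : ℂ) : (spectralMeasure ω).singularPart volume =
    ENNReal.ofReal (atomWeight ‖ω‖) • Measure.dirac (‖ω‖ + ‖ω‖⁻¹) :=
  (Measure.eq_singularPart (measurable_acDensity ω)
    ((mutuallySingular_dirac _ _).smul _) (add_comm _ _)).symm

theorem spectralMeasure_rnDeriv (ω : ℂ) :
    (spectralMeasure ω).rnDeriv volume =ᵐ[volume] acDensity ω :=
  (Measure.eq_rnDeriv (measurable_acDensity ω)
    ((mutuallySingular_dirac _ _).smul _) (add_comm _ _)).symm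

end AntiLinear

theorem proposition4p1 (ω : ℂ) :
    (∃ (ν : Measure ℝ) (ψ : ℝ → ℂ),
      AntiLinear.IsSpectralData (AntiLinear.antiJacobi ω) (AntiLinear.e 0) ν ψ) ∧
    ∀ (ν : Measure ℝ) (ψ : ℝ → ℂ),
      AntiLinear.IsSpectralData (AntiLinear.antiJacobi ω) (AntiLinear.e 0) ν ψ →
      ν = volume.withDensity (ν.rnDeriv volume) + ν.singularPart volume ∧
      ν.rnDeriv volume =ᵐ[volume] AntiLinear.acDensity ω ∧
      (ν.singularPart volume ≠ 0 ↔ 1 < ‖ω‖) ∧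
      (1 < ‖ω‖ → ν.singularPart volume =
        ENNReal.ofReal ((‖ω‖ ^ 2 - 1) / ‖ω‖ ^ 2) • Measure.dirac (‖ω‖ + ‖ω‖⁻¹)) ∧
      (∀ᵐ s ∂ν, s ∈ Icc (0 : ℝ) 2 → ψ s = ω * (s : ℂ) / (1 + (‖ω‖ : ℂ) ^ 2)) ∧
      (1 < ‖ω‖ → ψ (‖ω‖ + ‖ω‖⁻¹) = ω / (‖ω‖ : ℂ)) := by
  have hdata := AntiLinear.isSpectralData_spectralMeasure ω
  refine ⟨⟨_, _, hdata⟩, fun ν ψ h => ?_⟩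
  obtain rfl := h.measure_unique hdata
  have hψ : ∀ᵐ s ∂(AntiLinear.spectralMeasure ω), ψ s = AntiLinear.phaseFunction ω s := by
    filter_upwards [h.phase_unique hdata, AntiLinear.ae_ne_zero ω] with s h1 h2 using h1 h2
  have hsing := AntiLinear.spectralMeasure_singularPart ω
  refine ⟨?_, AntiLinear.spectralMeasure_rnDeriv ω, ?_, fun hω => ?_, ?_, fun hω => ?_⟩
  · rw [add_comm]
    exact Measure.haveLebesgueDecomposition_add _ _
  · rw [hsing]
    constructor
    · intro hne
      by_contra hω
      exact hne (by simp [AntiLinear.atomWeight, hω])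
    · intro hω h0
      have h1 := congrArg (fun μ => μ univ) h0
      simp only [Measure.smul_apply, measure_univ, smul_eq_mul, mul_one, Measure.coe_zero,
        Pi.zero_apply, ENNReal.ofReal_eq_zero] at h1
      exact absurd h1 (not_le.2 (AntiLinear.atomWeight_pos hω))
  · rw [hsing, AntiLinear.atomWeight, if_pos hω]
  · filter_upwards [hψ] with s hs _ using hs
  -- The same formula serves at the atom: (r + 1/r)/(1 + r²) = 1/r.
  · rw [AntiLinear.of_ae_spectralMeasure hω hψ, AntiLinear.phaseFunction]
    have h0 : (‖ω‖ : ℂ) ≠ 0 := by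
      rw [Ne, Complex.ofReal_eq_zero]
      linarith
    have h1 : (1 + (‖ω‖ : ℂ) ^ 2) ≠ 0 := by
      exact_mod_cast (by positivity : (1 + ‖ω‖ ^ 2 : ℝ) ≠ 0)
    push_cast
    field_simp
    ring
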